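/- Let $p\ge 1$. A word $w=w_1\cdots w_n$ over $\{0,1,2,\dots\}$ is a \emph{$p$-ascent sequence} if it is empty, or if $w_1=0$ and, for all $2\le i\le n$, $w_i\le p+\mathrm{asc}(w_1\cdots w_{i-1})$, where $\mathrm{asc}(w_1\cdots w_k)=|\{j: 1\le j<k,\ w_j<w_{j+1}\}|$. It is \emph{primitive} if no two consecutive letters are equal. Let $a_{n,p}$ (respectively $r_{n,p}$) be the number of all (respectively all primitive) $p$-ascent sequences of length $n$, and put $$A^{(p)}(t,z)=\sum_{w} t^{|w|}z^{|w|_0},\qquad A^{(p)}(t)=\sum_{n\ge 0}a_{n,p}t^n,\qquad R^{(p)}(t)=\sum_{n\ge 0}r_{n,p}t^n,$$ where $w$ runs over all $p$-ascent sequences, $|w|$ is the length of $w$ and $|w|_0$ is the number of letters $0$ in $w$. Then, as formal power series in $t$ over $\mathbb{Z}$, $$R^{(p)}(t)=1+t\sum_{n=0}^{\infty}\binom{p-1+n}{n}(1+t)^n\prod_{i=1}^{n}\left(1-\left(\frac{1}{1+t}\right)^i\right),$$ where the infinite sum converges in the sense of formal power series (coefficientwise). Moreover $$A^{(p)}(t,1)=A^{(p)}(t)=R^{(p)}\!\left(\frac{t}{1-t}\right)\qquad\text{and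 equivalently}\qquad R^{(p)}(t)=A^{(p)}\!\left(\frac{t}{1+t}\right).$$ -/

import Mathlib

open scoped PowerSeries.WithPiTopology

namespace PAscent

/-- The number of ascents of a word `w = w₁ ⋯ wₙ`: the number of pairs of consecutive letters
`(wⱼ, wⱼ₊₁)` with `wⱼ < wⱼ₊₁`. -/
def asc (w : List ℕ) : ℕ :=
  (w.zip w.tail).countP fun q => q.1 < q.2

/-- `p`-ascent sequences (indices are 0-based here): the first letter is `0`, and every later letter
is at most `p` plus the number of ascents of the prefix that precedes it.
The empty word is a `p`-ascent sequence. -/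
def IsPAscent (p : ℕ) (w : List ℕ) : Prop :=
  (∀ h : 0 < w.length, w[0] = 0) ∧
    ∀ (i : ℕ) (hi : i < w.length), 1 ≤ i → w[i] ≤ p + asc (w.take i)

/-- Primitive words: no two consecutive letters are equal. -/
def IsPrimitive (w : List ℕ) : Prop :=
  w.IsChain (· ≠ ·)

theorem asc_le_length (w : List ℕ) : asc w ≤ w.length := by
  unfold asc
  refine List.countP_le_length.trans ?_
  simp

theorem IsPAscent.mem_le {p : ℕ} {w : List ℕ} (hw : IsPAscent p w) {a : ℕ} (ha : a ∈ w) :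
    a ≤ p + w.length := by
  obtain ⟨i, hi, rfl⟩ := List.getElem_of_mem ha
  rcases Nat.eq_zero_or_pos i with rfl | h
  · rw [hw.1 hi]; exact Nat.zero_le _
  · refine (hw.2 i hi h).trans ?_
    have := asc_le_length (w.take i)
    rw [List.length_take] at this
    omega

theorem finite_pAscent (p n : ℕ) : {w : List ℕ | IsPAscent p w ∧ w.length = n}.Finite := by
  refine ((List.finite_length_eq (Fin (p + n + 1)) n).image (List.map Fin.val)).subset ?_
  rintro w ⟨hw, hn⟩
  refine ⟨w.pmap (fun a ha => (⟨a, ha⟩ : Fin (p + n + 1))) ?_, ?_, ?_⟩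
  · intro a ha
    have := hw.mem_le ha
    omega
  · simpa using hn
  · simp [List.map_pmap]

/-- The finite set of `p`-ascent sequences of length `n`. -/
noncomputable def words (p n : ℕ) : Finset (List ℕ) :=
  (finite_pAscent p n).toFinset

open Classical in
/-- The finite set of primitive `p`-ascent sequences of length `n`. -/
noncomputable def primitiveWords (p n : ℕ) : Finset (List ℕ) :=
  (words p n).filter IsPrimitive

/-- `A⁽ᵖ⁾(t, z) = ∑ t ^ |w| z ^ |w|₀` over all `p`-ascent sequences `w`, where `|w|₀` is the number
of letters `0` of `w`: a formal power series in `t` with coefficients in `ℤ[z]`. -/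
noncomputable def A₂ (p : ℕ) : PowerSeries (Polynomial ℤ) :=
  PowerSeries.mk fun n => ∑ w ∈ words p n, (Polynomial.X : Polynomial ℤ) ^ w.count 0

/-- `A⁽ᵖ⁾(t) = ∑ a_{n,p} t ^ n`, where `a_{n,p}` is the number of `p`-ascent sequences of
length `n`. -/
noncomputable def A (p : ℕ) : PowerSeries ℤ :=
  PowerSeries.mk fun n => ((words p n).card : ℤ)

/-- `R⁽ᵖ⁾(t) = ∑ r_{n,p} t ^ n`, where `r_{n,p}` is the number of primitive `p`-ascent sequences
of length `n`. -/
noncomputable def R (p : ℕ) : PowerSeries ℤ :=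
  PowerSeries.mk fun n => ((primitiveWords p n).card : ℤ)

/-- The inverse `1 / f` of an integer power series `f` with constant term `1`. -/
noncomputable def inv (f : PowerSeries ℤ) : PowerSeries ℤ :=
  PowerSeries.invOfUnit f 1

theorem mul_inv {f : PowerSeries ℤ} (hf : PowerSeries.constantCoeff f = 1) : f * inv f = 1 :=
  PowerSeries.mul_invOfUnit f 1 (by simpa using hf)

/-- The substitution of `t f(t)` into a power series is legitimate, for every `f`. -/
theorem hasSubst_X_mul (f : PowerSeries ℤ) :
    PowerSeries.HasSubst (PowerSeries.X * f : PowerSeries ℤ) :=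
  PowerSeries.HasSubst.of_constantCoeff_zero' (by simp)

/-- The term `C(p-1+n, n) (1+t)ⁿ ∏_{i=1}^n (1 - (1/(1+t))ⁱ)`. -/
noncomputable def term (p n : ℕ) : PowerSeries ℤ :=
  ((p - 1 + n).choose n : PowerSeries ℤ) * (1 + PowerSeries.X) ^ n *
    ∏ i ∈ Finset.Icc 1 n, (1 - inv (1 + PowerSeries.X) ^ i)

end PAscent

/-! ### Words under the appending of one letter -/

namespace PAscent

/-! Build words letter by letter, remembering only the state (ascents `a`, last letter `l`). Summing
`f` over states, one more letter acts on `f` by `step` for primitive words and by `1 + step` for all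
words. The operators commute, so the binomial theorem gives `A(t) = R(t/(1-t))`, and the inverse
substitution gives the converse. The formula for `R` uses the kernel method. With `Z = 1/(1-x)` and
`Y = 1/(1-(1+t)x)`, the weight `Y^(p+a-l) Z^l` makes `x (f - t step f)` independent of `l`
(`kernel_identity`). Summed over primitive words this telescopes, and the coefficient of `x^(n+1)`
ties `G p n` to `G p (n+1)` (`G_recurrence`). Iterating from `G p 0 = (R - 1)/t` yields the series;
the remainder vanishes `t`-adically. -/

theorem asc_cons_cons (a b : ℕ) (l : List ℕ) :
    asc (a :: b :: l) = asc (b :: l) + if a < b then 1 else 0 := by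
  simp [asc, List.countP_cons]

/-- On the empty word the default `0` of `getLastD` would count a spurious ascent when `0 < j`. -/
theorem asc_append_singleton {w : List ℕ} (hw : w ≠ []) (j : ℕ) :
    asc (w ++ [j]) = asc w + if w.getLastD 0 < j then 1 else 0 := by
  induction w with
  | nil => exact absurd rfl hw
  | cons a l ih =>
    cases l with
    | nil => simp [asc]
    | cons b l =>
      have h := ih (by simp)
      simp only [List.cons_append, asc_cons_cons] at h ⊢
      rw [h]
      simp only [List.getLastD_cons]
      omega

theorem isPAscent_append_singleton {p : ℕ} {w : List ℕ} (hw : w ≠ []) (j : ℕ) :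
    IsPAscent p (w ++ [j]) ↔ IsPAscent p w ∧ j ≤ p + asc w := by
  have hl : 0 < w.length := List.length_pos_iff.2 hw
  constructor
  · rintro ⟨h0, h⟩
    refine ⟨⟨fun h' => ?_, fun i hi h1 => ?_⟩, ?_⟩
    · simpa [List.getElem_append_left h'] using h0 (by simp)
    · have := h i (by simp; omega) h1
      rwa [List.getElem_append_left hi, List.take_append_of_le_length hi.le] at this
    · simpa using h w.length (by simp) hl
  · rintro ⟨⟨h0, h⟩, hj⟩
    refine ⟨fun _ => ?_, fun i hi h1 => ?_⟩
    · rw [List.getElem_append_left hl]; exact h0 hl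
    · rcases Nat.lt_or_ge i w.length with hi' | hi'
      · rw [List.getElem_append_left hi', List.take_append_of_le_length hi'.le]
        exact h i hi' h1
      · obtain rfl : i = w.length := by simp at hi; omega
        simpa using hj

theorem isPrimitive_append_singleton {w : List ℕ} (hw : w ≠ []) (j : ℕ) :
    IsPrimitive (w ++ [j]) ↔ IsPrimitive w ∧ j ≠ w.getLastD 0 := by
  obtain ⟨v, a, rfl⟩ := List.eq_nil_or_concat w |>.resolve_left hw
  simp only [IsPrimitive, List.concat_eq_append]
  rw [List.isChain_append]
  simp [eq_comm]

theorem mem_words {p n : ℕ} {w : List ℕ} : w ∈ words p n ↔ IsPAscent p w ∧ w.length = n := by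
  simp [words]

theorem mem_primitiveWords {p n : ℕ} {w : List ℕ} :
    w ∈ primitiveWords p n ↔ (IsPAscent p w ∧ w.length = n) ∧ IsPrimitive w := by
  simp [primitiveWords, mem_words]

theorem words_zero (p : ℕ) : words p 0 = {[]} := by
  ext w
  simp only [mem_words, List.length_eq_zero_iff, Finset.mem_singleton, and_iff_right_iff_imp]
  rintro rfl
  simp [IsPAscent]

theorem words_one (p : ℕ) : words p 1 = {[0]} := by
  ext w
  simp only [mem_words, List.length_eq_one_iff, Finset.mem_singleton]
  constructor
  · rintro ⟨h, a, rfl⟩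
    simpa using h.1 (by simp)
  · rintro rfl
    refine ⟨⟨by simp, fun i hi h => ?_⟩, 0, rfl⟩
    simp at hi
    omega

theorem primitiveWords_zero (p : ℕ) : primitiveWords p 0 = {[]} := by
  simp [primitiveWords, words_zero, Finset.filter_singleton, IsPrimitive]

theorem primitiveWords_one (p : ℕ) : primitiveWords p 1 = {[0]} := by
  simp [primitiveWords, words_one, Finset.filter_singleton, IsPrimitive]

/-- This invariant makes repeating the last letter admissible and keeps the subtraction `p + a - l`
in `weight` from truncating. -/
theorem IsPAscent.getLastD_le {p : ℕ} {w : List ℕ} (hw : IsPAscent p w) :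
    w.getLastD 0 ≤ p + asc w := by
  rcases List.eq_nil_or_concat w with rfl | ⟨v, a, rfl⟩
  · simp
  · rw [List.concat_eq_append] at hw ⊢
    by_cases hv : v = []
    · subst hv
      have := hw.1 (by simp)
      simp_all
    · have h := ((isPAscent_append_singleton hv a).1 hw).2
      rw [asc_append_singleton hv]
      simp
      omega

/-! ### Transfer of sums over states -/

section Sums

variable {M : Type*} [AddCommMonoid M]

/-- The sum of `f` over the states (number of ascents, last letter) of the words obtained by
appending a letter different from the last one to a `p`-ascent sequence in the state `(a, l)`. -/
def step (p : ℕ) (f : ℕ → ℕ → M) (a l : ℕ) : M :=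
  ∑ j ∈ Finset.range l, f a j + ∑ j ∈ Finset.Ioc l (p + a), f (a + 1) j

theorem sum_erase_eq_step (p : ℕ) (f : ℕ → ℕ → M) {a l : ℕ} (h : l ≤ p + a) :
    ∑ j ∈ (Finset.range (p + a + 1)).erase l, f (a + if l < j then 1 else 0) j
      = step p f a l := by
  have hd : Disjoint (Finset.range l) (Finset.Ioc l (p + a)) :=
    Finset.disjoint_left.2 fun j h1 h2 => by simp at h1 h2; omega
  have : (Finset.range (p + a + 1)).erase l = Finset.range l ∪ Finset.Ioc l (p + a) := by
    ext j; simp; omega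
  rw [this, Finset.sum_union hd, step]
  refine congrArg₂ _ (Finset.sum_congr rfl fun j hj => ?_) (Finset.sum_congr rfl fun j hj => ?_)
  · rw [if_neg (by simp at hj; omega), add_zero]
  · rw [if_pos (by simp at hj; omega)]

theorem sum_range_eq_add_step (p : ℕ) (f : ℕ → ℕ → M) {a l : ℕ} (h : l ≤ p + a) :
    ∑ j ∈ Finset.range (p + a + 1), f (a + if l < j then 1 else 0) j
      = f a l + step p f a l := by
  rw [← sum_erase_eq_step p f h, ← Finset.add_sum_erase _ _ (a := l) (by simp; omega)]
  simp

/-- The sum of `f` over the states of the words in `s`. -/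
def stateSum (s : Finset (List ℕ)) (f : ℕ → ℕ → M) : M :=
  ∑ w ∈ s, f (asc w) (w.getLastD 0)

theorem stateSum_append (s t : Finset (List ℕ)) (c : List ℕ → Finset ℕ) (f : ℕ → ℕ → M)
    (hs : ∀ w ∈ s, w ≠ [])
    (ht : ∀ v, v ∈ t ↔ ∃ w ∈ s, ∃ j ∈ c w, v = w ++ [j]) :
    stateSum t f =
      ∑ w ∈ s, ∑ j ∈ c w, f (asc w + if w.getLastD 0 < j then 1 else 0) j := by
  rw [Finset.sum_sigma', stateSum]
  symm
  refine Finset.sum_bij (fun x _ => x.1 ++ [x.2]) ?_ ?_ ?_ ?_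
  · rintro ⟨w, j⟩ h
    rw [Finset.mem_sigma] at h
    exact (ht _).2 ⟨w, h.1, j, h.2, rfl⟩
  · rintro ⟨w, j⟩ - ⟨w', j'⟩ - h
    obtain ⟨h1, h2⟩ := List.append_inj' h rfl
    simp at h1 h2
    simp [h1, h2]
  · intro v hv
    obtain ⟨w, hw, j, hj, rfl⟩ := (ht v).1 hv
    exact ⟨⟨w, j⟩, Finset.mem_sigma.2 ⟨hw, hj⟩, rfl⟩
  · rintro ⟨w, j⟩ h
    rw [Finset.mem_sigma] at h
    simp [asc_append_singleton (hs w h.1)]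

theorem ne_nil_of_length_eq_succ {w : List ℕ} {m : ℕ} (h : w.length = m + 1) : w ≠ [] := by
  rintro rfl; simp at h

theorem stateSum_words_succ (p m : ℕ) (f : ℕ → ℕ → M) :
    stateSum (words p (m + 2)) f = stateSum (words p (m + 1)) (f + step p f) := by
  rw [stateSum_append (words p (m + 1)) _ (fun w => Finset.range (p + asc w + 1)), stateSum]
  · refine Finset.sum_congr rfl fun w hw => ?_
    exact sum_range_eq_add_step p f (mem_words.1 hw).1.getLastD_le
  · exact fun w hw => ne_nil_of_length_eq_succ (mem_words.1 hw).2
  · intro v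
    simp only [mem_words, Finset.mem_range, Nat.lt_succ_iff]
    constructor
    · rintro ⟨hv, hl⟩
      obtain ⟨w, j, rfl⟩ := List.eq_nil_or_concat v |>.resolve_left (ne_nil_of_length_eq_succ hl)
      simp only [List.concat_eq_append, List.length_append, List.length_singleton] at hv hl ⊢
      have hl' : w.length = m + 1 := by omega
      rw [isPAscent_append_singleton (ne_nil_of_length_eq_succ hl')] at hv
      exact ⟨w, ⟨hv.1, hl'⟩, j, hv.2, rfl⟩
    · rintro ⟨w, ⟨hw, hl⟩, j, hj, rfl⟩
      rw [isPAscent_append_singleton (ne_nil_of_length_eq_succ hl)]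
      exact ⟨⟨hw, hj⟩, by simp [hl]⟩

theorem stateSum_primitiveWords_succ (p m : ℕ) (f : ℕ → ℕ → M) :
    stateSum (primitiveWords p (m + 2)) f = stateSum (primitiveWords p (m + 1)) (step p f) := by
  rw [stateSum_append (primitiveWords p (m + 1)) _
    (fun w => (Finset.range (p + asc w + 1)).erase (w.getLastD 0)), stateSum]
  · refine Finset.sum_congr rfl fun w hw => ?_
    exact sum_erase_eq_step p f (mem_primitiveWords.1 hw).1.1.getLastD_le
  · exact fun w hw => ne_nil_of_length_eq_succ (mem_primitiveWords.1 hw).1.2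
  · intro v
    simp only [mem_primitiveWords, Finset.mem_range, Finset.mem_erase, Nat.lt_succ_iff]
    constructor
    · rintro ⟨⟨hv, hl⟩, hp⟩
      obtain ⟨w, j, rfl⟩ := List.eq_nil_or_concat v |>.resolve_left (ne_nil_of_length_eq_succ hl)
      simp only [List.concat_eq_append, List.length_append, List.length_singleton] at hv hl hp ⊢
      have hl' : w.length = m + 1 := by omega
      rw [isPAscent_append_singleton (ne_nil_of_length_eq_succ hl')] at hv
      rw [isPrimitive_append_singleton (ne_nil_of_length_eq_succ hl')] at hp
      exact ⟨w, ⟨⟨hv.1, hl'⟩, hp.1⟩, j, ⟨hp.2, hv.2⟩, rfl⟩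
    · rintro ⟨w, ⟨⟨hw, hl⟩, hp⟩, j, ⟨hj, hj'⟩, rfl⟩
      rw [isPAscent_append_singleton (ne_nil_of_length_eq_succ hl),
        isPrimitive_append_singleton (ne_nil_of_length_eq_succ hl)]
      exact ⟨⟨⟨hw, hj'⟩, by simp [hl]⟩, hp, hj⟩

end Sums

/-! ### Operator powers and the substitutions relating `A` and `R` -/

/-- `step` as a linear operator on integer-valued functions. -/
def stepEnd (p : ℕ) : Module.End ℤ (ℕ → ℕ → ℤ) where
  toFun := step p
  map_add' f g := by
    funext a l
    simp only [step, Pi.add_apply, Finset.sum_add_distrib]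
    ring
  map_smul' c f := by
    funext a l
    simp only [step, Pi.smul_apply, smul_eq_mul, ← Finset.mul_sum, RingHom.id_apply, mul_add]

/-- Removing the last letter changes `f`, so the induction runs over all `f`; it ends at the word
`[0]`, whose state is `(0, 0)`. -/
theorem stateSum_words (p m : ℕ) (f : ℕ → ℕ → ℤ) :
    stateSum (words p (m + 1)) f = ((stepEnd p + 1) ^ m) f 0 0 := by
  induction m generalizing f with
  | zero => simp [stateSum, words_one, asc]
  | succ m ih =>
    rw [stateSum_words_succ, ih, pow_succ, Module.End.mul_apply, add_comm f]
    rfl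

theorem stateSum_primitiveWords (p m : ℕ) (f : ℕ → ℕ → ℤ) :
    stateSum (primitiveWords p (m + 1)) f = (stepEnd p ^ m) f 0 0 := by
  induction m generalizing f with
  | zero => simp [stateSum, primitiveWords_one, asc]
  | succ m ih =>
    rw [stateSum_primitiveWords_succ, ih, pow_succ, Module.End.mul_apply]
    rfl

theorem card_eq_stateSum (s : Finset (List ℕ)) : (s.card : ℤ) = stateSum s fun _ _ => (1 : ℤ) := by
  simp [stateSum]

theorem card_words_succ (p m : ℕ) :
    ((words p (m + 1)).card : ℤ) =
      ∑ k ∈ Finset.range (m + 1), (m.choose k : ℤ) * (primitiveWords p (k + 1)).card := by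
  simp only [card_eq_stateSum, stateSum_words, stateSum_primitiveWords]
  rw [(Commute.one_right (stepEnd p)).add_pow]
  simp only [one_pow, mul_one, LinearMap.sum_apply, Finset.sum_apply]
  refine Finset.sum_congr rfl fun k _ => ?_
  rw [(Nat.cast_commute _ _).eq.symm, ← nsmul_eq_mul]
  simp

theorem constantCoeff_one_sub_X :
    PowerSeries.constantCoeff (1 - PowerSeries.X : PowerSeries ℤ) = 1 := by
  simp

theorem constantCoeff_one_add_X :
    PowerSeries.constantCoeff (1 + PowerSeries.X : PowerSeries ℤ) = 1 := by
  simp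

theorem inv_one_sub_X : inv (1 - PowerSeries.X) = PowerSeries.mk 1 := by
  have h1 := mul_inv constantCoeff_one_sub_X
  have h2 : (PowerSeries.mk 1 : PowerSeries ℤ) * (1 - PowerSeries.X) = 1 :=
    PowerSeries.mk_one_mul_one_sub_eq_one ℤ
  exact (left_inv_eq_right_inv h2 h1).symm

theorem coeff_X_mul_inv_pow (m k : ℕ) :
    PowerSeries.coeff (m + 1)
      ((PowerSeries.X * inv (1 - PowerSeries.X) : PowerSeries ℤ) ^ (k + 1)) = m.choose k := by
  rw [inv_one_sub_X, mul_pow, PowerSeries.mk_one_pow_eq_mk_choose_add,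
    PowerSeries.coeff_X_pow_mul']
  split_ifs with h
  · rw [PowerSeries.coeff_mk]
    congr 2
    omega
  · rw [Nat.choose_eq_zero_of_lt (by omega)]; simp

theorem A_eq_subst (p : ℕ) :
    A p = (R p).subst (PowerSeries.X * inv (1 - PowerSeries.X) : PowerSeries ℤ) := by
  ext n
  rw [PowerSeries.coeff_subst' (hasSubst_X_mul _)]
  cases n with
  | zero =>
    rw [finsum_eq_single _ 0]
    · simp [A, R, words_zero, primitiveWords_zero]
    · intro k hk
      simp [hk]
  | succ m =>
    have hsub : (Function.support fun d => PowerSeries.coeff d (R p) •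
        PowerSeries.coeff (m + 1)
          ((PowerSeries.X * inv (1 - PowerSeries.X) : PowerSeries ℤ) ^ d)) ⊆
        (Finset.range (m + 2) : Set ℕ) := by
      intro d hd
      by_contra hlt
      apply hd
      obtain ⟨k, rfl⟩ : ∃ k, d = k + 1 := ⟨d - 1, by simp at hlt; omega⟩
      simp only [coeff_X_mul_inv_pow]
      rw [Nat.choose_eq_zero_of_lt (by simp at hlt; omega)]
      simp
    -- The term `d = 0` is split off: it contributes nothing in positive degree, and the coefficient
    -- formula covers only exponents `k + 1`.
    rw [finsum_eq_sum_of_support_subset _ hsub, Finset.sum_range_succ']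
    simp only [coeff_X_mul_inv_pow]
    simp [A, R, card_words_succ, mul_comm, PowerSeries.coeff_one]

theorem R_eq_subst (p : ℕ) :
    R p = (A p).subst (PowerSeries.X * inv (1 + PowerSeries.X) : PowerSeries ℤ) := by
  have hB : PowerSeries.HasSubst (PowerSeries.X * inv (1 + PowerSeries.X) : PowerSeries ℤ) :=
    hasSubst_X_mul _
  have h1 := mul_inv constantCoeff_one_add_X
  have h2 := congrArg (PowerSeries.substAlgHom (R := ℤ) hB) (mul_inv constantCoeff_one_sub_X)
  rw [map_mul, map_sub, map_one, PowerSeries.substAlgHom_X] at h2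
  have h3 : (1 + PowerSeries.X : PowerSeries ℤ) *
      (1 - PowerSeries.X * inv (1 + PowerSeries.X)) = 1 := by
    linear_combination (-PowerSeries.X : PowerSeries ℤ) * h1
  -- Under `t ↦ t/(1+t)`, the series `1/(1-t)` becomes `1 + t`, so the two substitutions compose to
  -- the identity.
  have h4 := left_inv_eq_right_inv h3 h2
  rw [A_eq_subst, PowerSeries.subst_comp_subst_apply (hasSubst_X_mul _) hB,
    ← PowerSeries.coe_substAlgHom hB, map_mul, PowerSeries.substAlgHom_X, ← h4]
  have h5 : (PowerSeries.X * inv (1 + PowerSeries.X) : PowerSeries ℤ) * (1 + PowerSeries.X)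
      = PowerSeries.X := by linear_combination (PowerSeries.X : PowerSeries ℤ) * h1
  rw [h5, ← PowerSeries.map_algebraMap_eq_subst_X]
  simp

theorem map_A₂ (p : ℕ) : PowerSeries.map (Polynomial.evalRingHom (1 : ℤ)) (A₂ p) = A p := by
  ext n
  simp [A₂, A]

/-! ### The kernel method -/

section Kernel

variable {K : Type*} [CommRing K]

theorem sub_mul_sum_range (Y Z : K) {N l : ℕ} (h : l ≤ N + 1) :
    (Y - Z) * ∑ j ∈ Finset.range l, Y ^ (N - j) * Z ^ j = Y ^ (N + 1) - Y ^ (N + 1 - l) * Z ^ l := by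
  induction l with
  | zero => simp
  | succ l ih =>
    obtain ⟨d, rfl⟩ : ∃ d, N = l + d := ⟨N - l, by omega⟩
    rw [Finset.sum_range_succ, mul_add, ih (by omega)]
    rw [show l + d - l = d by omega, show l + d + 1 - l = d + 1 by omega,
      show l + d + 1 - (l + 1) = d by omega]
    ring

theorem sub_mul_sum_Ioc (Y Z : K) (l d : ℕ) :
    (Y - Z) * ∑ j ∈ Finset.Ioc l (l + d), Y ^ (l + d + 1 - j) * Z ^ j =
      Y ^ (d + 1) * Z ^ (l + 1) - Y * Z ^ (l + d + 1) := by
  induction d with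
  | zero => simp
  | succ d ih =>
    have h : ∑ j ∈ Finset.Ioc l (l + d), Y ^ (l + (d + 1) + 1 - j) * Z ^ j =
        Y * ∑ j ∈ Finset.Ioc l (l + d), Y ^ (l + d + 1 - j) * Z ^ j := by
      rw [Finset.mul_sum]
      refine Finset.sum_congr rfl fun j hj => ?_
      rw [Finset.mem_Ioc] at hj
      rw [show l + (d + 1) + 1 - j = (l + d + 1 - j) + 1 by omega]
      ring
    rw [← add_assoc, Finset.sum_Ioc_succ_top (by omega), add_assoc l d 1, h,
      show l + (d + 1) + 1 - (l + (d + 1)) = 1 by omega]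
    linear_combination Y * ih

/-- The weight of a state with `a` ascents and last letter `l`. -/
def weight (p : ℕ) (Y Z : K) (a l : ℕ) : K := Y ^ (p + a - l) * Z ^ l

/-- Both sums in `step` are geometric with denominator `Y - Z = t x Y Z`. After division, the terms
in `Y^d Z^l` (`d = p + a - l`) have total coefficient `x - (1 - z) = 0`, leaving no dependence on
`l`. -/
theorem kernel_identity (p : ℕ) {t x y z Y Z : K} (hy : y * Y = 1) (hz : z * Z = 1)
    (ht : z - y = t * x) (hx : 1 - z = x) {a l : ℕ} (h : l ≤ p + a) :
    x * (weight p Y Z a l - t * step p (weight p Y Z) a l) = Z ^ (p + a) - z * Y ^ (p + a) := by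
  obtain ⟨d, hd⟩ := Nat.exists_eq_add_of_le h
  have h1 := sub_mul_sum_range Y Z (N := p + a) (l := l) (by omega)
  have h2 := sub_mul_sum_Ioc Y Z l d
  simp only [step, weight, ← add_assoc]
  rw [hd] at h1 ⊢
  rw [show l + d + 1 - l = d + 1 by omega] at h1
  rw [show l + d - l = d by omega]
  generalize ∑ j ∈ Finset.range l, Y ^ (l + d - j) * Z ^ j = S at h1 ⊢
  generalize ∑ j ∈ Finset.Ioc l (l + d), Y ^ (l + d + 1 - j) * Z ^ j = S' at h2 ⊢
  have hYZ : Y - Z = t * x * (Y * Z) := by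
    linear_combination (Y * Z) * ht - Y * hz + Z * hy
  have hyz : (y * z) * (Y * Z) = 1 := by linear_combination z * Z * hy + hz
  have key : t * x * (S + S') = y * z * (Y ^ (l + d + 1) - Y ^ (d + 1) * Z ^ l
      + (Y ^ (d + 1) * Z ^ (l + 1) - Y * Z ^ (l + d + 1))) := by
    rw [← h1, ← h2, hYZ]
    linear_combination (-(t * x * (S + S'))) * hyz
  have e : y * z * (Y ^ (l + d + 1) - Y ^ (d + 1) * Z ^ l
      + (Y ^ (d + 1) * Z ^ (l + 1) - Y * Z ^ (l + d + 1))) =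
      z * Y ^ (l + d) - z * (Y ^ d * Z ^ l) + Y ^ d * Z ^ l - Z ^ (l + d) := by
    linear_combination (z * Y ^ (l + d) - z * Y ^ d * Z ^ l + z * Z * Y ^ d * Z ^ l
      - z * Z * Z ^ (l + d)) * hy + (Y ^ d * Z ^ l - Z ^ (l + d)) * hz
  linear_combination -key - e - (Y ^ d * Z ^ l) * hx

/-- Since `step` passes from length `m + 1` to `m + 2`, the sum telescopes, leaving the state `(0,
0)` of `[0]` and a tail of order `t^n`. -/
theorem sum_pow_mul_stateSum (p : ℕ) (t x : K) (f D : ℕ → ℕ → K)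
    (h : ∀ a l, l ≤ p + a → x * (f a l - t * step p f a l) = D a l) (n : ℕ) :
    ∑ m ∈ Finset.range n, t ^ m * stateSum (primitiveWords p (m + 1)) D =
      x * (f 0 0 - t ^ n * stateSum (primitiveWords p (n + 1)) f) := by
  induction n with
  | zero => simp [stateSum, primitiveWords_one, asc]
  | succ n ih =>
    have : stateSum (primitiveWords p (n + 1)) D = x * (stateSum (primitiveWords p (n + 1)) f
        - t * stateSum (primitiveWords p (n + 2)) f) := by
      rw [stateSum_primitiveWords_succ]
      simp only [stateSum]
      rw [Finset.mul_sum, ← Finset.sum_sub_distrib, Finset.mul_sum]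
      exact Finset.sum_congr rfl fun w hw =>
        (h _ _ (mem_primitiveWords.1 hw).1.1.getLastD_le).symm
    rw [Finset.sum_range_succ, ih, this]
    ring

end Kernel

/-! ### The recurrence in `n` and its iteration -/

open PowerSeries

/-- The generating function of the nonempty primitive `p`-ascent sequences `w`, by length minus
one, each one weighted by the number of multisets of size `n` of letters in `{1, …, p + asc w}`. -/
noncomputable def G (p n : ℕ) : PowerSeries ℤ :=
  mk fun m => stateSum (primitiveWords p (m + 1)) fun a _ => ((p - 1 + a + n).choose n : ℤ)

theorem X_pow_dvd_mk_sub_sum (c : ℕ → ℤ) (n : ℕ) :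
    (X : PowerSeries ℤ) ^ n ∣ mk c - ∑ m ∈ Finset.range n, X ^ m * C (c m) := by
  rw [X_pow_dvd_iff]
  intro k hk
  simp only [map_sub, coeff_mk, map_sum, coeff_mul_C, coeff_X_pow]
  rw [Finset.sum_eq_single k]
  · simp
  · intro b _ hb
    simp [hb.symm]
  · intro h
    simp [hk] at h

theorem coeff_mk_one_pow {S : Type*} [CommRing S] {N n : ℕ} (hN : 1 ≤ N) :
    coeff n ((mk 1 : PowerSeries S) ^ N) = ((N - 1 + n).choose n : S) := by
  obtain ⟨d, rfl⟩ : ∃ d, N = d + 1 := ⟨N - 1, by omega⟩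
  rw [mk_one_pow_eq_mk_choose_add, coeff_mk, Nat.choose_symm_add]
  rfl

/-- This is the coefficient of `x^(n+1)` in the telescoped kernel identity. The outer variable is
`x`, and `t` is the inner one, embedded as `C X`. -/
theorem G_recurrence {p : ℕ} (hp : 1 ≤ p) (n : ℕ) :
    (1 + X) ^ n * G p n - ((1 + X) ^ (n + 1) - 1) * G p (n + 1) =
      (1 + X) ^ n * ((p - 1 + n).choose n : PowerSeries ℤ) := by
  set s : PowerSeries ℤ := 1 + X with hs
  let Z : PowerSeries (PowerSeries ℤ) := mk 1
  let Y : PowerSeries (PowerSeries ℤ) := rescale s (mk 1)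
  have hz : (1 - X) * Z = 1 := by rw [mul_comm]; exact mk_one_mul_one_sub_eq_one _
  have hy : rescale s (1 - X) * Y = 1 := by rw [← map_mul, hz, map_one]
  have hk := fun a l h => kernel_identity (t := C (X : PowerSeries ℤ)) (x := X)
    p hy hz (by rw [map_sub, map_one, rescale_X, hs, map_add, map_one]; ring) (by ring)
    (a := a) (l := l) h
  have hcY (N k : ℕ) (hN : 1 ≤ N) :
      coeff k (Y ^ N) = s ^ k * ((N - 1 + k).choose k : PowerSeries ℤ) := by
    rw [← map_pow, coeff_rescale, coeff_mk_one_pow hN]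
  -- The factor `1 - x` in front of `Y^(p+a)` brings in the coefficient of `x^n` beside that of
  -- `x^(n+1)`.
  have hD (a : ℕ) : coeff (n + 1) (Z ^ (p + a) - (1 - X) * Y ^ (p + a)) =
      s ^ n * C ((p - 1 + a + n).choose n : ℤ)
        - (s ^ (n + 1) - 1) * C ((p - 1 + a + (n + 1)).choose (n + 1) : ℤ) := by
    rw [sub_mul, one_mul, map_sub, map_sub, coeff_succ_X_mul, hcY _ _ (by omega),
      hcY _ _ (by omega), coeff_mk_one_pow (by omega), show p + a - 1 = p - 1 + a by omega]
    simp only [map_natCast]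
    ring
  -- Only finite sums telescope, so the identity is proved modulo every power `t^M`.
  have hdvd (M : ℕ) : X ^ M ∣ s ^ n * G p n - (s ^ (n + 1) - 1) * G p (n + 1)
      - s ^ n * ((p - 1 + n).choose n : PowerSeries ℤ) := by
    have h := congrArg (coeff (n + 1)) (sum_pow_mul_stateSum p (C (X : PowerSeries ℤ)) X
      (weight p Y Z) (fun a _ => Z ^ (p + a) - (1 - X) * Y ^ (p + a)) hk M)
    rw [coeff_succ_X_mul, map_sub, map_sum] at h
    simp only [← map_pow, coeff_C_mul, stateSum] at h
    simp only [map_sum, hD] at h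
    rw [weight, pow_zero, mul_one, add_zero, tsub_zero, hcY _ _ hp] at h
    obtain ⟨u, hu⟩ := X_pow_dvd_mk_sub_sum (fun m =>
      stateSum (primitiveWords p (m + 1)) fun a _ => ((p - 1 + a + n).choose n : ℤ)) M
    obtain ⟨v, hv⟩ := X_pow_dvd_mk_sub_sum (fun m =>
      stateSum (primitiveWords p (m + 1)) fun a _ =>
        ((p - 1 + a + (n + 1)).choose (n + 1) : ℤ)) M
    rw [← G, sub_eq_iff_eq_add] at hu hv
    have hsum : ∑ m ∈ Finset.range M, X ^ m * ∑ w ∈ primitiveWords p (m + 1),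
        (s ^ n * C ((p - 1 + asc w + n).choose n : ℤ)
        - (s ^ (n + 1) - 1) * C ((p - 1 + asc w + (n + 1)).choose (n + 1) : ℤ)) =
        s ^ n * (∑ m ∈ Finset.range M, X ^ m * C (stateSum (primitiveWords p (m + 1))
          fun a _ => ((p - 1 + a + n).choose n : ℤ))) -
        (s ^ (n + 1) - 1) * (∑ m ∈ Finset.range M, X ^ m * C (stateSum (primitiveWords p (m + 1))
          fun a _ => ((p - 1 + a + (n + 1)).choose (n + 1) : ℤ))) := by
      rw [Finset.mul_sum, Finset.mul_sum, ← Finset.sum_sub_distrib]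
      refine Finset.sum_congr rfl fun m _ => ?_
      simp only [stateSum, map_sum, Finset.sum_sub_distrib, ← Finset.mul_sum]
      ring
    rw [hsum] at h
    rw [hu, hv]
    -- The quotient collects the truncation errors `u`, `v` of the two series and the telescoping
    -- tail, whose factor `x` lowers the index from `n + 1` to `n`.
    refine ⟨s ^ n * u - (s ^ (n + 1) - 1) * v - ∑ w ∈ primitiveWords p (M + 1),
      coeff n (weight p Y Z (asc w) (w.getLastD 0)), ?_⟩
    linear_combination h
  rw [← sub_eq_zero]
  ext k
  exact X_pow_dvd_iff.1 (hdvd (k + 1)) k k.lt_succ_self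

theorem G_zero_eq {p : ℕ} (hp : 1 ≤ p) (n : ℕ) :
    G p 0 = ∑ k ∈ Finset.range n, term p k +
      (1 + X) ^ n * (∏ i ∈ Finset.Icc 1 n, (1 - inv (1 + X) ^ i)) * G p n := by
  induction n with
  | zero => simp
  | succ n ih =>
    have hq : (1 + X : PowerSeries ℤ) ^ (n + 1) * inv (1 + X) ^ (n + 1) = 1 := by
      rw [← mul_pow, mul_inv constantCoeff_one_add_X, one_pow]
    rw [Finset.sum_range_succ, Finset.prod_Icc_succ_top (by omega), ih, term]
    linear_combination (∏ i ∈ Finset.Icc 1 n, (1 - inv (1 + X) ^ i)) * G_recurrence hp n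
      + (∏ i ∈ Finset.Icc 1 n, (1 - inv (1 + X) ^ i)) * G p (n + 1) * hq

/-- Each factor has constant term `1 - 1 = 0`. Hence both the remainder in `G_zero_eq` and the terms
of the series tend to zero. -/
theorem X_pow_dvd_prod (n : ℕ) :
    (X : PowerSeries ℤ) ^ n ∣ ∏ i ∈ Finset.Icc 1 n, (1 - inv (1 + X) ^ i) := by
  have h : ∏ _i ∈ Finset.Icc 1 n, (X : PowerSeries ℤ) ∣
      ∏ i ∈ Finset.Icc 1 n, (1 - inv (1 + X) ^ i) := by
    refine Finset.prod_dvd_prod_of_dvd _ _ fun i _ => ?_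
    have hc := congrArg constantCoeff (mul_inv constantCoeff_one_add_X)
    rw [map_mul, constantCoeff_one_add_X, one_mul, map_one] at hc
    rw [X_dvd_iff, map_sub, map_pow, hc]
    simp
  simpa using h

theorem hasSum_term {p : ℕ} (hp : 1 ≤ p) : HasSum (term p) (G p 0) := by
  rw [WithPiTopology.hasSum_iff_hasSum_coeff]
  intro d
  have h : coeff d (G p 0) = ∑ k ∈ Finset.range (d + 1), coeff d (term p k) := by
    rw [G_zero_eq hp (d + 1), map_add, map_sum, add_eq_left]
    exact X_pow_dvd_iff.1 (((X_pow_dvd_prod (d + 1)).mul_left _).mul_right _) d d.lt_succ_self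
  rw [h]
  refine hasSum_sum_of_ne_finset_zero fun n hn => ?_
  exact X_pow_dvd_iff.1 ((X_pow_dvd_prod n).mul_left _) d (by simp at hn; omega)

theorem R_eq_one_add_X_mul_G (p : ℕ) : R p = 1 + X * G p 0 := by
  ext n
  cases n with
  | zero => simp [R, primitiveWords_zero]
  | succ m => simp [R, G, coeff_one, stateSum, coeff_succ_X_mul]

end PAscent

theorem mainTheorem2 (p : ℕ) (hp : 1 ≤ p) :
    (Summable (fun n : ℕ => PAscent.term p n) ∧
      PAscent.R p = 1 + PowerSeries.X * ∑' n : ℕ, PAscent.term p n) ∧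
    PowerSeries.map (Polynomial.evalRingHom (1 : ℤ)) (PAscent.A₂ p) = PAscent.A p ∧
    PAscent.A p =
      (PAscent.R p).subst (PowerSeries.X * PAscent.inv (1 - PowerSeries.X) : PowerSeries ℤ) ∧
    PAscent.R p =
      (PAscent.A p).subst (PowerSeries.X * PAscent.inv (1 + PowerSeries.X) : PowerSeries ℤ) := by
  have h := PAscent.hasSum_term hp
  refine ⟨⟨h.summable, ?_⟩, PAscent.map_A₂ p, PAscent.A_eq_subst p, PAscent.R_eq_subst p⟩
  rw [h.tsum_eq, PAscent.R_eq_one_add_X_mul_G]
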